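/- Let $d\ge 3$, let $T_d$ be the infinite $d$-regular tree, and give $\mathrm{Aut}(T_d)$ the topology of pointwise convergence on the vertices. Fix a legal labelling of $T_d$, i.e. a labelling of the (undirected) edges by $\{1,\dots,d\}$ such that at every vertex $v$ the $d$ incident edges carry each label exactly once; write $\ell_v$ for the resulting bijection from the edges at $v$ to $\{1,\dots,d\}$. For $F\le S_d$ the Burger–Mozes group is $$U(F)=\{g\in\mathrm{Aut}(T_d) : \ell_{gv}\circ g\circ \ell_v^{-1}\in F\ \text{ for every vertex } v\},$$ with the subspace topology. A subgroup of $\mathrm{Aut}(T_d)$ is called geometrically dense if it leaves no proper (non-empty) subtree of $T_d$ invariant and fixes no end of $T_d$. The amenable radical of a locally compact group is its largest closed normal amenable subgroup. Let $F\le S_d$ be such that for every $l\in\{1,\dots,d\}$ the stabilizer $\mathrm{St}_F(l)$ acts transitively on $\{1,\dots,d\}\setminus\{l\}$. If $U(F)=\bigcup_{n\ge 0}L_n$ for a sequence $(L_n)_{n\ge0}$ of open subgroups of $U(F)$, then there is $n$ such that $L_n$ is geometrically dense. Moreover, $U(F)$ cannot be expressed as a union of (any family of) open subgroups each having open amenable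 radical. In particular, if $d\ge 4$, then the alternating group $F=A_d$ satisfies the hypothesis on stabilizers, and $U(A_d)$ cannot be expressed as a union of open subgroups each having open amenable radical. -/

import Mathlib

open scoped BoundedContinuousFunction

namespace BurgerMozes

section Tree

variable {V : Type*} {T : SimpleGraph V}

/-- The topology of pointwise convergence on the (discrete) set of vertices. -/
instance autTopology (T : SimpleGraph V) : TopologicalSpace (T ≃g T) :=
  TopologicalSpace.induced (fun (g : T ≃g T) (v : V) => g v)
    (@Pi.topologicalSpace V (fun _ => V) (fun _ => ⊥))

theorem isOpen_setOf_apply_eq (v w : V) : IsOpen {g : T ≃g T | g v = w} := by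
  let _ : TopologicalSpace V := ⊥
  have : DiscreteTopology V := ⟨rfl⟩
  have h : Continuous (fun g : T ≃g T => g v) :=
    (continuous_apply v).comp
      (continuous_induced_dom (f := fun (g : T ≃g T) (v : V) => g v))
  exact (isOpen_discrete ({w} : Set V)).preimage h

theorem continuous_aut_iff {X : Type*} [TopologicalSpace X] {f : X → (T ≃g T)} :
    Continuous f ↔ ∀ v w : V, IsOpen {x | f x v = w} := by
  constructor
  · intro h v w
    exact (isOpen_setOf_apply_eq v w).preimage h
  · intro h
    let _ : TopologicalSpace V := ⊥
    have : DiscreteTopology V := ⟨rfl⟩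
    refine continuous_induced_rng.2 (continuous_pi fun v => ?_)
    exact continuous_discrete_rng.2 fun w => h v w

instance autIsTopologicalGroup (T : SimpleGraph V) : IsTopologicalGroup (T ≃g T) where
  continuous_mul := by
    refine continuous_aut_iff.2 fun v w => ?_
    have : {x : (T ≃g T) × (T ≃g T) | (x.1 * x.2) v = w} =
        ⋃ u : V, {g : T ≃g T | g u = w} ×ˢ {g : T ≃g T | g v = u} := by
      ext ⟨a, b⟩
      simp [RelIso.mul_apply]
    rw [this]
    exact isOpen_iUnion fun u => (isOpen_setOf_apply_eq u w).prod (isOpen_setOf_apply_eq v u)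
  continuous_inv := by
    refine continuous_aut_iff.2 fun v w => ?_
    have : {g : T ≃g T | g⁻¹ v = w} = {g : T ≃g T | g w = v} := by
      ext g
      constructor
      · rintro rfl
        exact RelIso.apply_inv_self g v
      · rintro rfl
        exact RelIso.inv_apply_self g w
    rw [this]
    exact isOpen_setOf_apply_eq w v

/-- A ray: an infinite path without repeated vertices. -/
structure Ray (T : SimpleGraph V) where
  toFun : ℕ → V
  injective : Function.Injective toFun
  adj : ∀ n, T.Adj (toFun n) (toFun (n + 1))

/-- Two rays of a tree are equivalent if they agree from some point on, up to reindexing. -/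
instance raySetoid (T : SimpleGraph V) : Setoid (Ray T) where
  r ξ η := ∃ a b : ℕ, ∀ n, ξ.toFun (n + a) = η.toFun (n + b)
  iseqv :=
    { refl := fun _ => ⟨0, 0, fun _ => rfl⟩
      symm := fun ⟨a, b, h⟩ => ⟨b, a, fun n => (h n).symm⟩
      trans := by
        rintro ξ η ζ ⟨a, b, h⟩ ⟨c, e, k⟩
        refine ⟨c + a, b + e, fun n => ?_⟩
        have h1 := h (n + c)
        have h2 := k (n + b)
        rw [show n + (c + a) = n + c + a by omega, h1,
          show n + c + b = n + b + c by omega, h2,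
          show n + b + e = n + (b + e) by omega] }

/-- The boundary `∂T` of a tree: the set of its ends. -/
def Ends (T : SimpleGraph V) : Type _ := Quotient (raySetoid T)

/-- The image of a ray under an automorphism. -/
def Ray.map (g : T ≃g T) (ξ : Ray T) : Ray T where
  toFun n := g (ξ.toFun n)
  injective := g.injective.comp ξ.injective
  adj n := g.map_adj_iff.2 (ξ.adj n)

/-- The action of an automorphism on the ends. -/
def Ends.map (g : T ≃g T) : Ends T → Ends T :=
  Quotient.map (Ray.map g) fun _ _ ⟨a, b, h⟩ => ⟨a, b, fun n => congrArg g (h n)⟩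

/-- A subgroup of `Aut(T)`, for a tree `T`, is geometrically dense if it leaves no proper subtree
invariant and fixes no end. A subtree is given by its vertex set: a (non-empty) set of vertices
that spans a connected subgraph. -/
def GeometricallyDense (G : Subgroup (T ≃g T)) : Prop :=
  (∀ A : Set V, (T.induce A).Connected → (∀ g ∈ G, g '' A = A) → A = Set.univ) ∧
    ∀ ξ : Ends T, ∃ g ∈ G, ξ.map g ≠ ξ

/-- A legal labelling of the edges by `d` labels: at every vertex, each label
occurs on exactly one of the edges at that vertex. (Labels sit on undirected edges.) -/
structure LegalLabelling (T : SimpleGraph V) (d : ℕ) where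
  label : T.EdgeLabeling (Fin d)
  bijective : ∀ v, Function.Bijective fun w : T.neighborSet v => label.get v w w.2

namespace LegalLabelling

variable {d : ℕ} (ℓ : LegalLabelling T d)

/-- The bijection from the edges at `v` (that is, the neighbours of `v`) to the labels. -/
noncomputable def labelAt (v : V) : T.neighborSet v ≃ Fin d :=
  Equiv.ofBijective _ (ℓ.bijective v)

/-- The local action `σ(g, v) = ℓ_{g v} ∘ g ∘ ℓ_v⁻¹` of `g` at `v`. -/
noncomputable def localAction (g : T ≃g T) (v : V) : Equiv.Perm (Fin d) :=
  ((ℓ.labelAt v).symm.trans (g.mapNeighborSet v)).trans (ℓ.labelAt (g v))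

theorem localAction_one (v : V) : ℓ.localAction 1 v = 1 := by
  ext i
  exact congrArg Fin.val ((ℓ.labelAt v).apply_symm_apply i)

theorem localAction_mul (g h : T ≃g T) (v : V) :
    ℓ.localAction (g * h) v = ℓ.localAction g (h v) * ℓ.localAction h v := by
  ext i
  have : ((ℓ.labelAt (h v)).symm
      (ℓ.labelAt (h v) (h.mapNeighborSet v ((ℓ.labelAt v).symm i)))) =
      h.mapNeighborSet v ((ℓ.labelAt v).symm i) := Equiv.symm_apply_apply _ _
  simp only [localAction, Equiv.Perm.mul_apply, Equiv.trans_apply, this]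
  rfl

end LegalLabelling

/-- The Burger–Mozes group `U(F)`: the automorphisms all of whose local actions lie in `F`. -/
def burgerMozes {d : ℕ} (ℓ : LegalLabelling T d) (F : Subgroup (Equiv.Perm (Fin d))) :
    Subgroup (T ≃g T) where
  carrier := {g | ∀ v, ℓ.localAction g v ∈ F}
  one_mem' v := by
    rw [ℓ.localAction_one]
    exact F.one_mem
  mul_mem' {g h} hg hh v := by
    rw [ℓ.localAction_mul]
    exact F.mul_mem (hg _) (hh _)
  inv_mem' {g} hg v := by
    have h := ℓ.localAction_mul g g⁻¹ v
    rw [mul_inv_cancel, ℓ.localAction_one] at h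
    rw [← inv_eq_of_mul_eq_one_right h.symm]
    exact F.inv_mem (hg _)

end Tree

/-- Every point stabilizer of `F` acts transitively on the remaining points. -/
def StabilizersTransitive {d : ℕ} (F : Subgroup (Equiv.Perm (Fin d))) : Prop :=
  ∀ l i j : Fin d, i ≠ l → j ≠ l → ∃ σ ∈ F, σ l = l ∧ σ i = j

section Amenable

variable (G : Type*) [Group G] [TopologicalSpace G] [IsTopologicalGroup G]

/-- The left translate `x ↦ f (g * x)` of a bounded continuous function. -/
def leftTranslate {G : Type*} [Group G] [TopologicalSpace G] [IsTopologicalGroup G]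
    (g : G) (f : G →ᵇ ℝ) : G →ᵇ ℝ :=
  f.compContinuous ⟨fun x => g * x, continuous_const_mul g⟩

/-- Amenability of a (locally compact) group: there is a left-invariant mean on the bounded
continuous real functions. -/
def IsAmenable : Prop :=
  ∃ m : (G →ᵇ ℝ) →ₗ[ℝ] ℝ, (∀ f, 0 ≤ f → 0 ≤ m f) ∧ m 1 = 1 ∧
    ∀ (g : G) (f : G →ᵇ ℝ), m (leftTranslate g f) = m f

/-- The amenable radical: the closed subgroup generated by all closed normal amenable subgroups
(in a locally compact group it is the largest closed normal amenable subgroup). -/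
def amenableRadical : Subgroup G :=
  (sSup {N : Subgroup G | N.Normal ∧ IsClosed (N : Set G) ∧ IsAmenable N}).topologicalClosure

/-- `G` is the union of a family of open subgroups each of which has open amenable radical. -/
def IsUnionOfOpenSubgroupsWithOpenAmenableRadical : Prop :=
  ∃ 𝓛 : Set (Subgroup G),
    (∀ L ∈ 𝓛, IsOpen (L : Set G) ∧ IsOpen (amenableRadical L : Set L)) ∧
      (⋃ L ∈ 𝓛, (L : Set G)) = Set.univ

end Amenable

end BurgerMozes

/-!
The group `U(F)` contains a translation of length two along a line whose edges carry two
alternating labels (`exists_translation`), and in any covering of `U(F)` some member contains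
this element. Everything follows from a description of the open subgroups `L` that contain such
a translation: they contain every element of `U(F)` that is supported on a half-tree
(`IsLine.containsRist_of_adj`). Since `L` is open, it contains the elements supported on a
half-tree far out on the axis; conjugation by the translation spreads this to all half-trees along
the axis, in both directions. Among these elements are the rotations, whose local action is a
fixed `τ ∈ F` on the half-tree and trivial outside (`exists_rotation`). As the point stabilizers
of `F` are transitive on the remaining labels, the rotations move the axis through every vertex,
and conjugation reaches all half-trees.

Such a subgroup acts transitively on the neighbours of `x` while fixing `x`, for every vertex `x`
(`exists_mem_map_eq`). It is therefore geometrically dense (`geometricallyDense`).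

It also has no nontrivial amenable normal subgroup `N` (`eq_bot_of_normal_of_isAmenable`). Indeed,
if `n ∈ N` moves a vertex `u`, then `n` maps some half-tree `H` with complement `D` into `D`.
Rotations in `L` give three pairwise disjoint translates `l D`, and the conjugates `l n l⁻¹`, which
lie in `N`, map the complement of `l D` into `l D`. An invariant mean, transported to the subsets
of the tree by an orbit map, gives each `l D` mass at least `1 / 2`, which is absurd. Hence the
amenable radical of `L` is trivial, and it is not open because `L` contains rotations of
half-trees that avoid any given finite set (`not_isOpen_bot`).
-/

namespace BurgerMozes

/-! ### Half-trees -/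

section HalfTree

variable {V : Type*} {T : SimpleGraph V}

theorem dist_map_iso (hT : T.IsTree) (g : T ≃g T) (u v : V) :
    T.dist (g u) (g v) = T.dist u v := by
  have key : ∀ (h : T ≃g T) (x y : V), T.dist (h x) (h y) ≤ T.dist x y := by
    intro h x y
    obtain ⟨p, hp⟩ := hT.1.exists_walk_length_eq_dist x y
    have := SimpleGraph.dist_le (p.map h.toHom)
    rwa [SimpleGraph.Walk.length_map, hp] at this
  refine le_antisymm (key g u v) ?_
  have := key g⁻¹ (g u) (g v)
  rwa [RelIso.inv_apply_self, RelIso.inv_apply_self] at this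

theorem dist_adj (hT : T.IsTree) (r : V) {v w : V} (h : T.Adj v w) :
    T.dist r v = T.dist r w + 1 ∨ T.dist r w = T.dist r v + 1 :=
  hT.dist_eq_dist_add_one_of_adj r h

/-- In a tree, a vertex has at most one neighbour that is closer to a given root. -/
theorem eq_of_adj_of_dist_lt (hT : T.IsTree) {r v w w' : V} (h : T.Adj v w) (h' : T.Adj v w')
    (hw : T.dist r w < T.dist r v) (hw' : T.dist r w' < T.dist r v) : w = w' := by
  -- A path from `r` to `x`, followed by the edge from `x` to `v`, is the path from `r` to `v`.
  have aux : ∀ x, T.Adj v x → T.dist r x < T.dist r v →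
      ∃ p : T.Walk r v, p.IsPath ∧ p.penultimate = x := by
    intro x hx hlt
    obtain ⟨p, hp⟩ := hT.1.exists_walk_length_eq_dist r x
    refine ⟨p.concat hx.symm, ?_, by simp⟩
    apply SimpleGraph.Walk.isPath_of_length_eq_dist
    rw [SimpleGraph.Walk.length_concat, hp]
    have := dist_adj hT r hx
    omega
  obtain ⟨p, hp, rfl⟩ := aux w h hw
  obtain ⟨q, hq, rfl⟩ := aux w' h' hw'
  rw [(hT.existsUnique_path r v).unique hp hq]

theorem exists_adj_dist_lt (hT : T.IsTree) {r v : V} (h : v ≠ r) :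
    ∃ w, T.Adj v w ∧ T.dist r v = T.dist r w + 1 := by
  obtain ⟨p, hp⟩ := hT.1.exists_walk_length_eq_dist v r
  cases p with
  | nil => exact absurd rfl h
  | cons hadj q =>
    rename_i w
    refine ⟨w, hadj, ?_⟩
    have h1 := SimpleGraph.dist_le q
    rw [SimpleGraph.Walk.length_cons] at hp
    have := dist_adj hT r hadj
    rw [T.dist_comm (u := w), T.dist_comm (u := v)] at *
    omega

/-- The half-tree `T_{a → b}` of an oriented edge `(a, b)`: the vertices closer to `b`
than to `a`. -/
def halfTree (T : SimpleGraph V) (a b : V) : Set V := {v | T.dist v b < T.dist v a}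

theorem mem_halfTree {a b v : V} : v ∈ halfTree T a b ↔ T.dist v b < T.dist v a := Iff.rfl

theorem notMem_halfTree (hT : T.IsTree) {a b v : V} (h : T.Adj a b) :
    v ∉ halfTree T a b ↔ v ∈ halfTree T b a := by
  simp only [mem_halfTree]
  have := dist_adj hT v h
  omega

theorem right_mem_halfTree (hT : T.IsTree) {a b : V} (h : T.Adj a b) : b ∈ halfTree T a b := by
  rw [mem_halfTree, SimpleGraph.dist_self]
  exact hT.1.pos_dist_of_ne h.ne'

theorem left_notMem_halfTree {a b : V} : a ∉ halfTree T a b := by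
  simp [mem_halfTree]

theorem map_mem_halfTree (hT : T.IsTree) (g : T ≃g T) {a b v : V} :
    g v ∈ halfTree T (g a) (g b) ↔ v ∈ halfTree T a b := by
  simp only [mem_halfTree, dist_map_iso hT]

theorem mem_halfTree_map (hT : T.IsTree) (g : T ≃g T) {a b v : V} :
    v ∈ halfTree T (g a) (g b) ↔ g⁻¹ v ∈ halfTree T a b := by
  rw [← map_mem_halfTree hT g (v := g⁻¹ v), RelIso.apply_inv_self]

theorem disjoint_halfTree (hT : T.IsTree) {b c c' : V} (h : T.Adj b c) (h' : T.Adj b c')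
    (hne : c ≠ c') : Disjoint (halfTree T b c) (halfTree T b c') := by
  rw [Set.disjoint_left]
  intro v hv hv'
  exact hne (eq_of_adj_of_dist_lt hT h h' hv hv')

theorem halfTree_subset (hT : T.IsTree) {a b c : V} (h : T.Adj a b) (h' : T.Adj b c)
    (hne : c ≠ a) : halfTree T b c ⊆ halfTree T a b := by
  intro v hv
  rw [← notMem_halfTree hT h.symm]
  exact Set.disjoint_left.1 (disjoint_halfTree hT h' h.symm hne) hv

/-- The only edge joining the half-tree `T_{a → b}` to its complement is the one from `b`
to `a`. -/
theorem eq_of_adj_of_mem_halfTree (hT : T.IsTree) {a b v w : V} (hab : T.Adj a b)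
    (hvw : T.Adj v w) (hv : v ∈ halfTree T a b) (hw : w ∉ halfTree T a b) : v = b ∧ w = a := by
  rw [notMem_halfTree hT hab] at hw
  rw [mem_halfTree] at hv hw
  have d1 := dist_adj hT a hvw
  have d2 := dist_adj hT b hvw
  have d3 := dist_adj hT v hab
  have d4 := dist_adj hT w hab
  rw [T.dist_comm (u := v) (v := a), T.dist_comm (u := v) (v := b)] at *
  rw [T.dist_comm (u := w) (v := a), T.dist_comm (u := w) (v := b)] at *
  -- `v` lies as far beyond `b` as `w` lies beyond `a`, and both distances must vanish: otherwise
  -- the neighbour of `w` towards `a` and `v` are two neighbours of `w` towards `b`.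
  have hk : T.dist b v = T.dist a w := by omega
  have hwa : w = a := by
    by_contra hwa
    obtain ⟨w', hw', hd⟩ := exists_adj_dist_lt hT hwa
    have e1 := dist_adj hT w' hab
    rw [T.dist_comm (u := w') (v := a), T.dist_comm (u := w') (v := b)] at e1
    have : v = w' := eq_of_adj_of_dist_lt (r := b) hT hvw.symm hw' (by omega) (by omega)
    subst this
    omega
  subst hwa
  rw [SimpleGraph.dist_self, hT.1.dist_eq_zero_iff] at hk
  exact ⟨hk.symm, rfl⟩

/-- A nonempty set of vertices of a connected graph that is closed under passing to
neighbours contains all vertices. -/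
theorem eq_univ_of_adj_closed (hT : T.Connected) {A : Set V} (hne : A.Nonempty)
    (h : ∀ v ∈ A, ∀ w, T.Adj v w → w ∈ A) : A = Set.univ := by
  obtain ⟨a, ha⟩ := hne
  refine Set.eq_univ_of_forall fun v => ?_
  obtain ⟨p⟩ := hT.preconnected a v
  induction p with
  | nil => exact ha
  | cons hadj _ ih => exact ih (h _ ha _ hadj)

theorem disjoint_halfTree_of_notMem (hT : T.IsTree) {a b a' b' : V} (h : T.Adj a b)
    (h' : T.Adj a' b') (hne : a ≠ a') (ha : a ∉ halfTree T a' b') (ha' : a' ∉ halfTree T a b) :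
    Disjoint (halfTree T a b) (halfTree T a' b') := by
  rw [Set.disjoint_iff_inter_eq_empty]
  by_contra hinter
  -- An edge leaving the intersection would join `b` to `a` as well as `b'` to `a'`.
  have huniv := eq_univ_of_adj_closed hT.1 (Set.nonempty_iff_ne_empty.2 hinter) fun v hv w hw => by
    by_contra hw'
    rcases not_and_or.1 hw' with hw' | hw'
    · obtain ⟨rfl, rfl⟩ := eq_of_adj_of_mem_halfTree hT h hw hv.1 hw'
      exact hne (eq_of_adj_of_mem_halfTree hT h' hw hv.2 ha).2
    · obtain ⟨rfl, rfl⟩ := eq_of_adj_of_mem_halfTree hT h' hw hv.2 hw'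
      exact hne (eq_of_adj_of_mem_halfTree hT h hw hv.1 ha').2.symm
  exact left_notMem_halfTree (huniv ▸ Set.mem_univ a : a ∈ halfTree T a b ∩ _).1

/-- A locally injective endomorphism of a tree is an isometry. -/
theorem dist_map_of_locally_injective (hT : T.IsTree) {φ : V → V}
    (hadj : ∀ v w, T.Adj v w → T.Adj (φ v) (φ w))
    (hinj : ∀ v w w', T.Adj v w → T.Adj v w' → φ w = φ w' → w = w') (r v : V) :
    T.dist (φ r) (φ v) = T.dist r v := by
  induction hn : T.dist r v using Nat.strong_induction_on generalizing v with
  | _ n ih =>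
    by_cases hv : v = r
    · subst hv
      rw [← hn, SimpleGraph.dist_self, SimpleGraph.dist_self]
    obtain ⟨w, hvw, hw⟩ := exists_adj_dist_lt hT hv
    have h1 := ih (T.dist r w) (by omega) w rfl
    have h2 := dist_adj hT (φ r) (hadj _ _ hvw)
    by_cases hwr : w = r
    · subst hwr
      rw [SimpleGraph.dist_self] at h1 hw
      rw [SimpleGraph.dist_self] at h2
      omega
    obtain ⟨z, hwz, hz⟩ := exists_adj_dist_lt hT hwr
    have h3 := ih (T.dist r z) (by omega) z rfl
    have h4 : ¬ T.dist (φ r) (φ v) < T.dist (φ r) (φ w) := by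
      intro hlt
      have : φ v = φ z :=
        eq_of_adj_of_dist_lt hT (hadj _ _ hvw.symm) (hadj _ _ hwz) hlt (by omega)
      have := hinj _ _ _ hvw.symm hwz this
      subst this
      omega
    omega

end HalfTree

/-! ### Automorphisms with prescribed local actions -/

namespace LegalLabelling

variable {V : Type*} {T : SimpleGraph V} {d : ℕ} (ℓ : LegalLabelling T d)

/-- The neighbour of `v` along the edge at `v` with label `c`. -/
noncomputable def nbr (v : V) (c : Fin d) : V := (ℓ.labelAt v).symm c

theorem adj_nbr (v : V) (c : Fin d) : T.Adj v (ℓ.nbr v c) := ((ℓ.labelAt v).symm c).2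

theorem nbr_injective (v : V) : Function.Injective (ℓ.nbr v) :=
  Subtype.val_injective.comp (ℓ.labelAt v).symm.injective

theorem nbr_labelAt (v : V) (w : T.neighborSet v) : ℓ.nbr v (ℓ.labelAt v w) = w :=
  congrArg Subtype.val ((ℓ.labelAt v).symm_apply_apply w)

theorem exists_eq_nbr {v w : V} (h : T.Adj v w) : ∃ c, w = ℓ.nbr v c :=
  ⟨ℓ.labelAt v ⟨w, h⟩, (ℓ.nbr_labelAt v ⟨w, h⟩).symm⟩

theorem nbr_nbr (v : V) (c : Fin d) : ℓ.nbr (ℓ.nbr v c) c = v := by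
  have h : T.Adj (ℓ.nbr v c) v := (ℓ.adj_nbr v c).symm
  have h1 : ℓ.labelAt (ℓ.nbr v c) ⟨v, h⟩ = c := by
    have h2 : ℓ.labelAt v ((ℓ.labelAt v).symm c) = c := (ℓ.labelAt v).apply_symm_apply c
    refine Eq.trans ?_ h2
    exact ℓ.label.get_comm _ _ _
  have := ℓ.nbr_labelAt (ℓ.nbr v c) ⟨v, h⟩
  rwa [h1] at this

theorem map_nbr (g : T ≃g T) (v : V) (c : Fin d) :
    g (ℓ.nbr v c) = ℓ.nbr (g v) (ℓ.localAction g v c) := by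
  have := ℓ.nbr_labelAt (g v) (g.mapNeighborSet v ((ℓ.labelAt v).symm c))
  exact this.symm

theorem localAction_eq_of_map_nbr {g : T ≃g T} {v : V} {σ : Equiv.Perm (Fin d)}
    (h : ∀ c, g (ℓ.nbr v c) = ℓ.nbr (g v) (σ c)) : ℓ.localAction g v = σ := by
  ext c
  rw [ℓ.nbr_injective (g v) ((ℓ.map_nbr g v c).symm.trans (h c))]

/-- A family of permutations which is compatible along the edges is the family of
local actions of an automorphism, whose value at one vertex can be prescribed. -/
theorem exists_aut_of_localAction (hT : T.IsTree) (σ : V → Equiv.Perm (Fin d))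
    (hσ : ∀ v c, σ (ℓ.nbr v c) c = σ v c) (v₀ w₀ : V) :
    ∃ g : T ≃g T, g v₀ = w₀ ∧ ∀ v, ℓ.localAction g v = σ v := by
  have hκ : ∀ v, v ≠ v₀ → ∃ c, T.dist v₀ v = T.dist v₀ (ℓ.nbr v c) + 1 := by
    intro v hv
    obtain ⟨w, hw, hd⟩ := exists_adj_dist_lt hT hv
    obtain ⟨c, rfl⟩ := ℓ.exists_eq_nbr hw
    exact ⟨c, hd⟩
  -- `κ v` is the label of the edge from `v` towards the root `v₀`.
  choose κ hκ using hκ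
  classical
  -- `Φ n` is the automorphism on the sphere of radius `n` around `v₀`.
  let Φ : ℕ → V → V := fun n => Nat.rec (fun _ => w₀) (fun _ φ v =>
    if h : v = v₀ then w₀ else ℓ.nbr (φ (ℓ.nbr v (κ v h))) (σ v (κ v h))) n
  let φ : V → V := fun v => Φ (T.dist v₀ v) v
  have hφ₀ : φ v₀ = w₀ := by
    simp only [φ, SimpleGraph.dist_self]
    rfl
  have hφκ : ∀ v (h : v ≠ v₀), φ v = ℓ.nbr (φ (ℓ.nbr v (κ v h))) (σ v (κ v h)) := by
    intro v h
    simp only [φ]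
    rw [hκ v h]
    simp only [Φ]
    rw [dif_neg h]
  have hφ : ∀ v c, φ (ℓ.nbr v c) = ℓ.nbr (φ v) (σ v c) := by
    intro v c
    rcases dist_adj hT v₀ (ℓ.adj_nbr v c) with h | h
    · have hv : v ≠ v₀ := by
        rintro rfl
        rw [SimpleGraph.dist_self] at h
        omega
      have hc : c = κ v hv := by
        refine ℓ.nbr_injective v (eq_of_adj_of_dist_lt (r := v₀) hT (ℓ.adj_nbr v _)
          (ℓ.adj_nbr v _) (by omega) ?_)
        have := hκ v hv
        omega
      rw [hφκ v hv, ← hc, ℓ.nbr_nbr]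
    · have hv : ℓ.nbr v c ≠ v₀ := by
        intro h0
        rw [h0, SimpleGraph.dist_self] at h
        omega
      have hc : c = κ _ hv := by
        refine ℓ.nbr_injective (ℓ.nbr v c) (eq_of_adj_of_dist_lt (r := v₀) hT (ℓ.adj_nbr _ _)
          (ℓ.adj_nbr _ _) ?_ ?_)
        · rw [ℓ.nbr_nbr]
          omega
        · have := hκ _ hv
          omega
      rw [hφκ _ hv, ← hc, ℓ.nbr_nbr, hσ]
  have hadj : ∀ v w, T.Adj v w → T.Adj (φ v) (φ w) := by
    intro v w h
    obtain ⟨c, rfl⟩ := ℓ.exists_eq_nbr h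
    rw [hφ]
    exact ℓ.adj_nbr _ _
  have hdist := dist_map_of_locally_injective hT hadj (by
    intro v w w' h h' e
    obtain ⟨c, rfl⟩ := ℓ.exists_eq_nbr h
    obtain ⟨c', rfl⟩ := ℓ.exists_eq_nbr h'
    rw [hφ, hφ] at e
    rw [(σ v).injective (ℓ.nbr_injective _ e)])
  have hinj : Function.Injective φ := by
    intro v w h
    rw [← hT.1.dist_eq_zero_iff, ← hdist, h, SimpleGraph.dist_self]
  have hsurj : Function.Surjective φ := by
    rw [← Set.range_eq_univ]
    refine eq_univ_of_adj_closed hT.1 ⟨_, v₀, rfl⟩ ?_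
    rintro _ ⟨v, rfl⟩ w h
    obtain ⟨c, rfl⟩ := ℓ.exists_eq_nbr h
    exact ⟨ℓ.nbr v ((σ v).symm c), by rw [hφ, Equiv.apply_symm_apply]⟩
  let g : T ≃g T :=
    { Equiv.ofBijective φ ⟨hinj, hsurj⟩ with
      map_rel_iff' := by
        intro v w
        change T.Adj (φ v) (φ w) ↔ T.Adj v w
        rw [← SimpleGraph.dist_eq_one_iff_adj, hdist, SimpleGraph.dist_eq_one_iff_adj] }
  exact ⟨g, hφ₀, fun v => ℓ.localAction_eq_of_map_nbr (hφ v)⟩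

end LegalLabelling

/-! ### Rotations of half-trees in the Burger–Mozes group -/

section Rotation

variable {V : Type*} {T : SimpleGraph V} {d : ℕ} (ℓ : LegalLabelling T d)
  {F : Subgroup (Equiv.Perm (Fin d))}

/-- For `τ ∈ F` fixing the label `a`, the group `U(F)` contains the rotation around `x` that acts
by `τ` on the edges at `x` and is supported on the half-tree at `x` opposite to the edge
labelled `a`. -/
theorem exists_rotation (hT : T.IsTree) {τ : Equiv.Perm (Fin d)} (hτ : τ ∈ F) (x : V)
    {a : Fin d} (ha : τ a = a) :
    ∃ u ∈ burgerMozes ℓ F, (∀ v ∉ halfTree T (ℓ.nbr x a) x, u v = v) ∧ u x = x ∧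
      ∀ c, u (ℓ.nbr x c) = ℓ.nbr x (τ c) := by
  classical
  set p := ℓ.nbr x a with hp
  have hpx : T.Adj p x := (ℓ.adj_nbr x a).symm
  -- The local action is `τ` on the half-tree and trivial outside. This is compatible because
  -- `τ` fixes the label of the only edge that leaves the half-tree.
  let σ : V → Equiv.Perm (Fin d) := fun v => if v ∈ halfTree T p x then τ else 1
  have hin : ∀ v ∈ halfTree T p x, σ v = τ := fun v hv => if_pos hv
  have hout : ∀ v ∉ halfTree T p x, σ v = 1 := fun v hv => if_neg hv
  have cross : ∀ v c, v ∈ halfTree T p x → ℓ.nbr v c ∉ halfTree T p x → τ c = c := by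
    intro v c h1 h2
    obtain ⟨rfl, h⟩ := eq_of_adj_of_mem_halfTree hT hpx (ℓ.adj_nbr v c) h1 h2
    rw [ℓ.nbr_injective v (h.trans hp), ha]
  have hσ : ∀ v c, σ (ℓ.nbr v c) c = σ v c := by
    intro v c
    by_cases h1 : v ∈ halfTree T p x <;> by_cases h2 : ℓ.nbr v c ∈ halfTree T p x
    · rw [hin _ h1, hin _ h2]
    · rw [hin _ h1, hout _ h2, cross v c h1 h2, Equiv.Perm.one_apply]
    · have := cross (ℓ.nbr v c) c h2 (by rwa [ℓ.nbr_nbr])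
      rw [hout _ h1, hin _ h2, this, Equiv.Perm.one_apply]
    · rw [hout _ h1, hout _ h2]
  obtain ⟨u, hu, hloc⟩ := ℓ.exists_aut_of_localAction hT σ hσ p p
  have hfix : ∀ v, v ∉ halfTree T p x → u v = v := by
    intro v
    induction hn : T.dist p v generalizing v with
    | zero =>
      rw [hT.1.dist_eq_zero_iff] at hn
      subst hn
      exact fun _ => hu
    | succ n ih =>
      intro hv
      have hvp : v ≠ p := by
        rintro rfl
        simp at hn
      obtain ⟨w, hvw, hd⟩ := exists_adj_dist_lt hT hvp
      have hw : w ∉ halfTree T p x := fun hw =>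
        hvp (eq_of_adj_of_mem_halfTree hT hpx hvw.symm hw hv).2
      obtain ⟨c, rfl⟩ := ℓ.exists_eq_nbr hvw.symm
      rw [ℓ.map_nbr, hloc, ih w (by omega) hw, hout _ hw, Equiv.Perm.one_apply]
  have hx : u x = x := by
    have h1 := ℓ.map_nbr u p a
    rw [hloc, hout _ left_notMem_halfTree, hu, Equiv.Perm.one_apply, hp, ℓ.nbr_nbr] at h1
    exact h1
  refine ⟨u, ?_, hfix, hx, fun c => ?_⟩
  · intro v
    rw [hloc]
    by_cases h : v ∈ halfTree T p x
    · rwa [hin _ h]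
    · rw [hout _ h]
      exact F.one_mem
  · rw [ℓ.map_nbr, hloc, hx, hin _ (right_mem_halfTree hT hpx)]

theorem exists_rotation_map_eq (hT : T.IsTree) (hF : StabilizersTransitive F) {p x y z : V}
    (hp : T.Adj x p) (hy : T.Adj x y) (hz : T.Adj x z) (hyp : y ≠ p) (hzp : z ≠ p) :
    ∃ u ∈ burgerMozes ℓ F, (∀ v ∉ halfTree T p x, u v = v) ∧ u x = x ∧ u y = z := by
  obtain ⟨a, rfl⟩ := ℓ.exists_eq_nbr hp
  obtain ⟨b, rfl⟩ := ℓ.exists_eq_nbr hy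
  obtain ⟨c, rfl⟩ := ℓ.exists_eq_nbr hz
  obtain ⟨τ, hτ, ha, hb⟩ := hF a b c (fun h => hyp (h ▸ rfl)) (fun h => hzp (h ▸ rfl))
  obtain ⟨u, hu, hfix, hx, hloc⟩ := exists_rotation ℓ hT hτ x ha
  exact ⟨u, hu, hfix, hx, by rw [hloc, hb]⟩

include ℓ in
theorem exists_adj_ne_ne (hd : 3 ≤ d) (x y z : V) : ∃ w, T.Adj x w ∧ w ≠ y ∧ w ≠ z := by
  classical
  by_contra! h
  have hsub : Finset.univ.image (ℓ.nbr x) ⊆ ({y, z} : Finset V) := by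
    intro w hw
    obtain ⟨c, -, rfl⟩ := Finset.mem_image.1 hw
    rw [Finset.mem_insert, Finset.mem_singleton, or_iff_not_imp_left]
    exact h _ (ℓ.adj_nbr x c)
  have h1 := Finset.card_le_card hsub
  rw [Finset.card_image_of_injective _ (ℓ.nbr_injective x), Finset.card_univ,
    Fintype.card_fin] at h1
  have h2 := Finset.card_le_two (a := y) (b := z)
  omega

/-- `K` contains the rigid stabilizer in `U(F)` of the half-tree `T_{p → x}`: all elements
of `U(F)` that fix the complement of the half-tree pointwise. -/
def ContainsRist (F : Subgroup (Equiv.Perm (Fin d))) (K : Subgroup (T ≃g T)) (p x : V) : Prop :=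
  ∀ u ∈ burgerMozes ℓ F, (∀ v ∉ halfTree T p x, u v = v) → u ∈ K

variable {ℓ} {K : Subgroup (T ≃g T)}

theorem ContainsRist.mono {p x q y : V} (h : ContainsRist ℓ F K p x)
    (hsub : halfTree T q y ⊆ halfTree T p x) : ContainsRist ℓ F K q y :=
  fun u hu hfix => h u hu fun v hv => hfix v fun hv' => hv (hsub hv')

theorem ContainsRist.map (hT : T.IsTree) (hK : K ≤ burgerMozes ℓ F) {p x : V}
    (h : ContainsRist ℓ F K p x) {g : T ≃g T} (hg : g ∈ K) : ContainsRist ℓ F K (g p) (g x) := by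
  intro u hu hfix
  have h1 : g⁻¹ * u * g ∈ K := by
    refine h _ (mul_mem (mul_mem (inv_mem (hK hg)) hu) (hK hg)) fun v hv => ?_
    rw [RelIso.mul_apply, RelIso.mul_apply, hfix (g v), RelIso.inv_apply_self]
    rwa [map_mem_halfTree hT]
  have h2 := mul_mem (mul_mem hg h1) (inv_mem hg)
  rwa [show g * (g⁻¹ * u * g) * g⁻¹ = u by group] at h2

end Rotation

/-! ### Bi-infinite geodesics and translations -/

section Axis

variable {V : Type*} {T : SimpleGraph V}

/-- A bi-infinite path without backtracking. -/
structure IsLine (T : SimpleGraph V) (a : ℤ → V) : Prop where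
  adj : ∀ i, T.Adj (a i) (a (i + 1))
  ne : ∀ i, a (i + 2) ≠ a i

theorem IsLine.reverse {a : ℤ → V} (h : IsLine T a) : IsLine T fun i => a (-i) where
  adj i := by
    have := (h.adj (-(i + 1))).symm
    rwa [show -(i + 1) + 1 = -i by ring] at this
  ne i := by
    have := (h.ne (-(i + 2))).symm
    rwa [show -(i + 2) + 2 = -i by ring] at this

theorem IsLine.halfTree_antitone (hT : T.IsTree) {a : ℤ → V} (h : IsLine T a) :
    Antitone fun i => halfTree T (a i) (a (i + 1)) := by
  refine antitone_int_of_succ_le fun i => ?_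
  refine halfTree_subset hT (h.adj i) (h.adj (i + 1)) ?_
  have := h.ne i
  rwa [show i + 2 = i + 1 + 1 by ring] at this

/-- The half-trees along a bi-infinite geodesic leave every finite set. -/
theorem IsLine.exists_forall_notMem (hT : T.IsTree) {a : ℤ → V} (h : IsLine T a)
    (S : Finset V) : ∃ N : ℤ, ∀ i ≥ N, ∀ v ∈ S, v ∉ halfTree T (a i) (a (i + 1)) := by
  have hev : ∀ᶠ i in Filter.atTop, ∀ v ∈ S, v ∉ halfTree T (a i) (a (i + 1)) := by
    rw [Filter.eventually_all_finset]
    intro v _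
    have hex : ∃ i, v ∉ halfTree T (a i) (a (i + 1)) := by
      -- Otherwise the distance to `v` would decrease forever along the geodesic.
      by_contra! hall
      have key : ∀ n : ℕ, T.dist v (a n) + n ≤ T.dist v (a 0) := by
        intro n
        induction n with
        | zero => simp
        | succ n ih =>
          have := mem_halfTree.1 (hall n)
          push_cast
          omega
      have := key (T.dist v (a 0) + 1)
      omega
    obtain ⟨i, hi⟩ := hex
    exact Filter.eventually_atTop.2 ⟨i, fun j hj hv => hi (h.halfTree_antitone hT hj hv)⟩
  exact Filter.eventually_atTop.1 hev

variable {d : ℕ} {ℓ : LegalLabelling T d} {F : Subgroup (Equiv.Perm (Fin d))}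
  {K : Subgroup (T ≃g T)}

/-- Conjugation by the translation spreads the rigid stabilizers of the half-trees far out on
the axis to all half-trees that point in the same direction along the axis. -/
theorem IsLine.containsRist (hT : T.IsTree) (hK : K ≤ burgerMozes ℓ F) {a : ℤ → V}
    (h : IsLine T a) {g : T ≃g T} (hg : g ∈ K) (hga : ∀ i, g (a i) = a (i + 2))
    {S : Finset V} (hS : ∀ u ∈ burgerMozes ℓ F, (∀ v ∈ S, u v = v) → u ∈ K) (i : ℤ) :
    ContainsRist ℓ F K (a i) (a (i + 1)) := by
  obtain ⟨N, hN⟩ := h.exists_forall_notMem hT S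
  have hback : ∀ i, g⁻¹ (a i) = a (i - 2) := by
    intro i
    rw [show i = i - 2 + 2 by ring, ← hga, RelIso.inv_apply_self]
    ring_nf
  have key : ∀ n : ℕ, ∀ i, N ≤ i + 2 * n → ContainsRist ℓ F K (a i) (a (i + 1)) := by
    intro n
    induction n with
    | zero =>
      intro i hi u hu hfix
      exact hS u hu fun v hv => hfix v (hN i (by simpa using hi) v hv)
    | succ n ih =>
      intro i hi
      have := (ih (i + 2) (by push_cast at hi; linarith)).map hT hK (inv_mem hg)
      rw [hback, hback] at this
      convert this using 2 <;> ring
  exact key (N - i).toNat i (by have := Int.self_le_toNat (N - i); omega)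

/-- A subgroup of `U(F)` that contains the pointwise stabilizer of a finite set and a
translation contains the rigid stabilizers of all half-trees: conjugation by the translation
gives the half-trees along its axis, and rotating these half-trees moves the axis through
every vertex. -/
theorem IsLine.containsRist_of_adj (hT : T.IsTree) (hF : StabilizersTransitive F)
    (hK : K ≤ burgerMozes ℓ F) {a : ℤ → V}
    (h : IsLine T a) {g : T ≃g T} (hg : g ∈ K) (hga : ∀ i, g (a i) = a (i + 2))
    {S : Finset V} (hS : ∀ u ∈ burgerMozes ℓ F, (∀ v ∈ S, u v = v) → u ∈ K) {p x : V}
    (hpx : T.Adj p x) : ContainsRist ℓ F K p x := by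
  have hfwd := h.containsRist hT hK hg hga hS
  have hbwd : ∀ i, ContainsRist ℓ F K (a (i + 1)) (a i) := by
    intro i
    have := h.reverse.containsRist hT hK (inv_mem hg) (fun i => ?_) hS (-(i + 1))
    · simpa using this
    · rw [show -i = -(i + 2) + 2 by ring, ← hga, RelIso.inv_apply_self]
  have hfwd' : ∀ l ∈ K, ∀ j, ContainsRist ℓ F K (l (a (j - 1))) (l (a j)) := by
    intro l hl j
    have := (hfwd (j - 1)).map hT hK hl
    rwa [show j - 1 + 1 = j by ring] at this
  have hadj : ∀ (l : T ≃g T) j, T.Adj (l (a j)) (l (a (j - 1))) := by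
    intro l j
    have := (h.adj (j - 1)).symm
    rw [show j - 1 + 1 = j by ring] at this
    exact l.map_adj_iff.2 this
  have hne : ∀ j, a (j + 1) ≠ a (j - 1) := by
    intro j
    have := h.ne (j - 1)
    rwa [show j - 1 + 2 = j + 1 by ring] at this
  have huniv : {v | ∃ l ∈ K, ∃ j, v = l (a j)} = Set.univ := by
    refine eq_univ_of_adj_closed hT.1 ⟨a 0, 1, K.one_mem, 0, rfl⟩ ?_
    rintro _ ⟨l, hl, j, rfl⟩ w hw
    by_cases hwj : w = l (a (j - 1))
    · exact ⟨l, hl, j - 1, hwj⟩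
    obtain ⟨u, hu, hfix, -, huw⟩ := exists_rotation_map_eq ℓ hT hF (hadj l j)
      (l.map_adj_iff.2 (h.adj j)) hw (fun e => hne j (l.injective e)) hwj
    exact ⟨u * l, mul_mem (hfwd' l hl j u hu hfix) hl, j + 1, huw.symm⟩
  obtain ⟨l, hl, j, rfl⟩ : p ∈ {v | ∃ l ∈ K, ∃ j, v = l (a j)} := huniv ▸ Set.mem_univ p
  by_cases hx : x = l (a (j - 1))
  · subst hx
    have := (hbwd (j - 1)).map hT hK hl
    rwa [show j - 1 + 1 = j by ring] at this
  · exact (hfwd' l hl j).mono (halfTree_subset hT (hadj l j).symm hpx hx)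

/-- `U(F)` contains a translation of length two. -/
theorem exists_translation (hT : T.IsTree) (hd : 3 ≤ d) (ℓ : LegalLabelling T d)
    (F : Subgroup (Equiv.Perm (Fin d))) :
    ∃ g ∈ burgerMozes ℓ F, ∃ a : ℤ → V, IsLine T a ∧ ∀ i, g (a i) = a (i + 2) := by
  obtain ⟨v₀⟩ := hT.1.nonempty
  let c₀ : Fin d := ⟨0, by omega⟩
  let c₁ : Fin d := ⟨1, by omega⟩
  have hc : c₀ ≠ c₁ := by simp [c₀, c₁, Fin.ext_iff]
  -- The axis passes through the vertices reached from `v₀` along alternating labels.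
  set v₁ := ℓ.nbr v₀ c₀ with hv₁
  obtain ⟨g, hg₀, hg⟩ := ℓ.exists_aut_of_localAction hT (fun _ => 1) (fun _ _ => rfl) v₀
    (ℓ.nbr v₁ c₁)
  have hgn : ∀ v c, g (ℓ.nbr v c) = ℓ.nbr (g v) c := by
    intro v c
    rw [ℓ.map_nbr, hg, Equiv.Perm.one_apply]
  have hne₀ : g v₀ ≠ v₀ := by
    intro e
    have h1 : ℓ.nbr v₁ c₀ = v₀ := ℓ.nbr_nbr v₀ c₀
    exact hc (ℓ.nbr_injective v₁ (h1.trans (e.symm.trans hg₀)))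
  have hne₁ : g v₁ ≠ v₁ := by
    intro e
    have h1 : ℓ.nbr (g v₀) c₁ = v₁ := by rw [hg₀, ℓ.nbr_nbr]
    rw [hv₁, hgn, ← hv₁] at e
    exact hc (ℓ.nbr_injective (g v₀) (e.trans h1.symm))
  let b : ℤ → V := fun i => if Even i then v₀ else v₁
  let a : ℤ → V := fun i => (g ^ (i / 2)) (b i)
  have heven : ∀ k : ℤ, a (2 * k) = (g ^ k) v₀ := by
    intro k
    simp [a, b]
  have hodd : ∀ k : ℤ, a (2 * k + 1) = (g ^ k) v₁ := by
    intro k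
    have : (2 * k + 1) / 2 = k := by omega
    simp [a, b, this]
  have hsucc : ∀ (k : ℤ) v, (g ^ (k + 1)) v = (g ^ k) (g v) := by
    intro k v
    rw [zpow_add_one, RelIso.mul_apply]
  refine ⟨g, fun v => by rw [hg]; exact F.one_mem, a, ⟨fun i => ?_, fun i => ?_⟩, fun i => ?_⟩ <;>
    obtain ⟨k, rfl | rfl⟩ := Int.even_or_odd' i
  · rw [heven, hodd]
    exact (g ^ k).map_adj_iff.2 (ℓ.adj_nbr v₀ c₀)
  · rw [hodd, show 2 * k + 1 + 1 = 2 * (k + 1) by ring, heven, hsucc, hg₀]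
    exact (g ^ k).map_adj_iff.2 (ℓ.adj_nbr v₁ c₁)
  · rw [show 2 * k + 2 = 2 * (k + 1) by ring, heven, heven, hsucc]
    exact fun e => hne₀ ((g ^ k).injective e)
  · rw [show 2 * k + 1 + 2 = 2 * (k + 1) + 1 by ring, hodd, hodd, hsucc]
    exact fun e => hne₁ ((g ^ k).injective e)
  · rw [show 2 * k + 2 = 2 * (k + 1) by ring, heven, heven, add_comm, zpow_one_add,
      RelIso.mul_apply]
  · rw [show 2 * k + 1 + 2 = 2 * (k + 1) + 1 by ring, hodd, hodd, add_comm k, zpow_one_add,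
      RelIso.mul_apply]

end Axis

/-! ### Geometric density -/

section Density

variable {V : Type*} {T : SimpleGraph V} {d : ℕ} {ℓ : LegalLabelling T d}
  {F : Subgroup (Equiv.Perm (Fin d))} {K : Subgroup (T ≃g T)}

/-- A subgroup that contains the rigid stabilizers of all half-trees acts transitively on the
neighbours of each vertex while fixing that vertex. -/
theorem exists_mem_map_eq (hT : T.IsTree) (hd : 3 ≤ d) (hF : StabilizersTransitive F)
    (hK : ∀ p x, T.Adj p x → ContainsRist ℓ F K p x) {x y z : V}
    (hy : T.Adj x y) (hz : T.Adj x z) : ∃ u ∈ K, u x = x ∧ u y = z := by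
  obtain ⟨p, hp, hpy, hpz⟩ := exists_adj_ne_ne ℓ hd x y z
  obtain ⟨u, hu, hfix, hx, huy⟩ := exists_rotation_map_eq ℓ hT hF hp hy hz hpy.symm hpz.symm
  exact ⟨u, hK _ _ hp.symm u hu hfix, hx, huy⟩

theorem eq_univ_of_invariant (hT : T.IsTree) (hd : 3 ≤ d) (hF : StabilizersTransitive F)
    (hK : ∀ p x, T.Adj p x → ContainsRist ℓ F K p x) {A : Set V}
    (hA : (T.induce A).Connected) (hinv : ∀ g ∈ K, g '' A = A) : A = Set.univ := by
  have hmem : ∀ g ∈ K, ∀ v ∈ A, g v ∈ A := fun g hg v hv =>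
    hinv g hg ▸ Set.mem_image_of_mem g hv
  obtain ⟨⟨v₀, hv₀⟩⟩ := hA.nonempty
  refine eq_univ_of_adj_closed hT.1 ⟨v₀, hv₀⟩ fun v hv w hvw => ?_
  -- `v` is not the only vertex of `A`: it is moved by a rotation around `w`.
  obtain ⟨v', hv', hne, -⟩ := exists_adj_ne_ne ℓ hd w v v
  obtain ⟨u, hu, -, huv⟩ := exists_mem_map_eq hT hd hF hK hvw.symm hv'
  have hv'A : v' ∈ A := huv ▸ hmem u hu v hv
  have : Nontrivial A := ⟨⟨v, hv⟩, ⟨v', hv'A⟩, fun e => hne (congrArg Subtype.val e).symm⟩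
  obtain ⟨⟨y, hyA⟩, hy⟩ := hA.preconnected.exists_adj_of_nontrivial ⟨v, hv⟩
  obtain ⟨u', hu', -, huy⟩ := exists_mem_map_eq hT hd hF hK (SimpleGraph.comap_adj.1 hy) hvw
  exact huy ▸ hmem u' hu' y hyA

theorem Ray.mem_halfTree (hT : T.IsTree) (ξ : Ray T) (n : ℕ) :
    ξ.toFun (n + 2) ∈ halfTree T (ξ.toFun 1) (ξ.toFun 2) := by
  have hsub : ∀ n, halfTree T (ξ.toFun (n + 1)) (ξ.toFun (n + 2)) ⊆
      halfTree T (ξ.toFun 1) (ξ.toFun 2) := by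
    intro n
    induction n with
    | zero => exact subset_rfl
    | succ n ih =>
      refine (halfTree_subset hT (ξ.adj _) (ξ.adj _) fun e => ?_).trans ih
      have := ξ.injective e
      omega
  exact hsub n (right_mem_halfTree hT (ξ.adj _))

theorem exists_map_end_ne (hT : T.IsTree) (hd : 3 ≤ d) (hF : StabilizersTransitive F)
    (hK : ∀ p x, T.Adj p x → ContainsRist ℓ F K p x) (ξ : Ends T) : ∃ g ∈ K, ξ.map g ≠ ξ := by
  induction ξ using Quotient.inductionOn with
  | _ ξ =>
    obtain ⟨z, hz, hz2, -⟩ := exists_adj_ne_ne ℓ hd (ξ.toFun 1) (ξ.toFun 2) (ξ.toFun 2)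
    -- A rotation around the second vertex moves the ray into a disjoint half-tree.
    obtain ⟨u, hu, hx, huz⟩ := exists_mem_map_eq hT hd hF hK (ξ.adj 1) hz
    refine ⟨u, hu, fun e => ?_⟩
    obtain ⟨a, b, hab⟩ : (ξ.map u) ≈ ξ := Quotient.exact e
    have h1 : u (ξ.toFun (a + 2)) ∈ halfTree T (ξ.toFun 1) z := by
      rw [← hx, ← huz, map_mem_halfTree hT]
      exact ξ.mem_halfTree hT a
    have h2 := ξ.mem_halfTree hT b
    have h3 : u (ξ.toFun (2 + a)) = ξ.toFun (2 + b) := hab 2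
    rw [add_comm 2 a, add_comm 2 b] at h3
    rw [h3] at h1
    exact Set.disjoint_left.1 (disjoint_halfTree hT hz (ξ.adj 1) hz2) h1 h2

theorem geometricallyDense (hT : T.IsTree) (hd : 3 ≤ d) (hF : StabilizersTransitive F)
    (hK : ∀ p x, T.Adj p x → ContainsRist ℓ F K p x) : GeometricallyDense K :=
  ⟨fun _ hA hinv => eq_univ_of_invariant hT hd hF hK hA hinv,
    exists_map_end_ne hT hd hF hK⟩

end Density

/-! ### Invariant means on groups acting on trees -/

section Mean

variable {V : Type*} {T : SimpleGraph V}

/-- The function `x ↦ 1_Q(x v)` on a group that acts continuously by automorphisms. -/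
noncomputable def orbitIndicator {G : Type*} [Group G] [TopologicalSpace G]
    (ρ : G →* (T ≃g T)) (hρ : Continuous ρ) (Q : Set V) (v : V) : G →ᵇ ℝ :=
  BoundedContinuousFunction.mkOfBound
    ⟨fun x => Q.indicator 1 (ρ x v), by
      have : IsLocallyConstant fun x => ρ x v := by
        rw [IsLocallyConstant.iff_isOpen_fiber]
        exact continuous_aut_iff.1 hρ v
      exact (this.comp (Q.indicator (1 : V → ℝ))).continuous⟩ 2 (by
    intro x y
    classical
    simp only [ContinuousMap.coe_mk, Set.indicator_apply, Pi.one_apply]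
    split_ifs <;> norm_num)

theorem orbitIndicator_apply {G : Type*} [Group G] [TopologicalSpace G]
    (ρ : G →* (T ≃g T)) (hρ : Continuous ρ) (Q : Set V) (v : V) (x : G) :
    orbitIndicator ρ hρ Q v x = Q.indicator 1 (ρ x v) := rfl

/-- An amenable group has no three elements that map the complements of three pairwise disjoint
sets into these sets: each of the sets would have mean at least `1 / 2`. -/
theorem IsAmenable.not_three_disjoint {G : Type*} [Group G] [TopologicalSpace G]
    [IsTopologicalGroup G] (hG : IsAmenable G) (ρ : G →* (T ≃g T)) (hρ : Continuous ρ)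
    [Nonempty V] (Q : Fin 3 → Set V) (hQ : Pairwise fun i j => Disjoint (Q i) (Q j)) (n : Fin 3 → G)
    (hn : ∀ i, ∀ v ∉ Q i, ρ (n i) v ∈ Q i) : False := by
  classical
  obtain ⟨m, hpos, hone, hinv⟩ := hG
  obtain ⟨v⟩ := ‹Nonempty V›
  have hmono : ∀ f g : G →ᵇ ℝ, (∀ x, f x ≤ g x) → m f ≤ m g := by
    intro f g h
    have := hpos (g - f) fun x => by simpa using h x
    rw [map_sub] at this
    linarith
  let f : Fin 3 → (G →ᵇ ℝ) := fun i => orbitIndicator ρ hρ (Q i) v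
  have hf : ∀ i x, f i x = if ρ x v ∈ Q i then 1 else 0 := by
    intro i x
    simp [f, orbitIndicator_apply, Set.indicator_apply]
  have hhalf : ∀ i, 1 ≤ 2 * m (f i) := by
    intro i
    have h1 : m 1 ≤ m (f i + leftTranslate (n i) (f i)) := by
      refine hmono _ _ fun x => ?_
      have h2 : leftTranslate (n i) (f i) x = f i (n i * x) := rfl
      rw [BoundedContinuousFunction.add_apply, h2, hf, hf, map_mul, RelIso.mul_apply]
      by_cases h : ρ x v ∈ Q i
      · rw [if_pos h]
        split_ifs <;> norm_num
      · rw [if_neg h, if_pos (hn i _ h)]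
        norm_num
    rw [map_add, hinv, hone] at h1
    linarith
  have hsum : m (f 0 + f 1 + f 2) ≤ m 1 := by
    refine hmono _ _ fun x => ?_
    have hd : ∀ i j, i ≠ j → ρ x v ∈ Q i → ρ x v ∉ Q j := fun i j hij h =>
      Set.disjoint_left.1 (show Disjoint (Q i) (Q j) from hQ hij) h
    have h01 := hd 0 1 (by decide)
    have h02 := hd 0 2 (by decide)
    have h12 := hd 1 2 (by decide)
    simp only [BoundedContinuousFunction.add_apply, hf, BoundedContinuousFunction.coe_one,
      Pi.one_apply]
    split_ifs <;> first | (norm_num; done) | tauto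
  rw [map_add, map_add, hone] at hsum
  linarith [hhalf 0, hhalf 1, hhalf 2]

end Mean

/-! ### Amenable radicals of open subgroups -/

section Radical

variable {V : Type*} {T : SimpleGraph V} {d : ℕ} {ℓ : LegalLabelling T d}
  {F : Subgroup (Equiv.Perm (Fin d))}

theorem t2Space_aut (T : SimpleGraph V) : T2Space (T ≃g T) := by
  let _ : TopologicalSpace V := ⊥
  have : DiscreteTopology V := ⟨rfl⟩
  exact T2Space.of_injective_continuous (f := fun (g : T ≃g T) (v : V) => g v)
    DFunLike.coe_injective continuous_induced_dom

/-- A neighbourhood of `1` in `U(F)` contains the pointwise stabilizer of a finite set of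
vertices. -/
theorem exists_finset_of_isOpen {O : Set (burgerMozes ℓ F)} (hO : IsOpen O) (h1 : 1 ∈ O) :
    ∃ S : Finset V, ∀ u (hu : u ∈ burgerMozes ℓ F), (∀ v ∈ S, u v = v) → ⟨u, hu⟩ ∈ O := by
  let _ : TopologicalSpace V := ⊥
  obtain ⟨W, hW, rfl⟩ := isOpen_induced_iff.1 hO
  obtain ⟨X, hX, rfl⟩ := isOpen_induced_iff.1 hW
  obtain ⟨S, t, ht, hsub⟩ := isOpen_pi_iff.1 hX _ h1
  refine ⟨S, fun u hu hfix => hsub fun v hv => ?_⟩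
  change u v ∈ t v
  rw [hfix v hv]
  exact (ht v hv).2

/-- If `n` moves `u`, then it maps some half-tree `T_{u → w}` into its complement
`T_{w → u}`. -/
theorem exists_halfTree_map_disjoint (hT : T.IsTree) (hd : 3 ≤ d) (ℓ : LegalLabelling T d)
    {n : T ≃g T} {u : V} (hu : n u ≠ u) :
    ∃ w, T.Adj w u ∧ ∀ v ∉ halfTree T w u, n v ∈ halfTree T w u := by
  -- `y` is the neighbour of `u` towards `n u`, and `n z` that of `n u` towards `u`.
  obtain ⟨y, hy, hyd⟩ := exists_adj_dist_lt hT hu.symm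
  obtain ⟨z', hz', hzd⟩ := exists_adj_dist_lt hT hu
  obtain ⟨w, hw, hwy, hwz⟩ := exists_adj_ne_ne ℓ hd u y (n⁻¹ z')
  refine ⟨w, hw.symm, fun v hv => ?_⟩
  rw [notMem_halfTree hT hw.symm] at hv
  rw [← notMem_halfTree hT hw]
  have hnw : T.Adj (n u) (n w) := n.map_adj_iff.2 hw
  have h1 : n u ∉ halfTree T u w := fun h =>
    hwy (eq_of_adj_of_dist_lt hT hw hy h (by omega))
  have h2 : u ∉ halfTree T (n u) (n w) := fun h =>
    hwz (by rw [← eq_of_adj_of_dist_lt hT hnw hz' h (by omega), RelIso.inv_apply_self])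
  have h3 : n v ∈ halfTree T (n u) (n w) := (map_mem_halfTree hT n).2 hv
  exact Set.disjoint_left.1 (disjoint_halfTree_of_notMem hT hnw hw hu h1 h2) h3

/-- If `N` contains a nontrivial element, then it contains conjugates of it that map the
complements of three pairwise disjoint half-trees into these half-trees. -/
theorem eq_bot_of_normal_of_isAmenable (hT : T.IsTree) (hd : 3 ≤ d)
    (hF : StabilizersTransitive F) {L : Subgroup (burgerMozes ℓ F)}
    (hL : ∀ p x, T.Adj p x → ContainsRist ℓ F (L.map (burgerMozes ℓ F).subtype) p x)
    (N : Subgroup L) [hN : N.Normal] (ham : IsAmenable N) : N = ⊥ := by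
  have := hT.1.nonempty
  let ρ : L →* (T ≃g T) := (burgerMozes ℓ F).subtype.comp L.subtype
  have hρinj : Function.Injective ρ :=
    Subtype.val_injective.comp Subtype.val_injective
  have hρ : Continuous (ρ.comp N.subtype) :=
    continuous_subtype_val.comp (continuous_subtype_val.comp continuous_subtype_val)
  by_contra hne
  obtain ⟨n, hn, hn1⟩ := N.bot_or_exists_ne_one.resolve_left hne
  obtain ⟨u, hu⟩ : ∃ u, ρ n u ≠ u := by
    by_contra! h
    refine hn1 (hρinj ?_)
    rw [map_one]
    exact RelIso.ext h
  obtain ⟨w, hwu, hw⟩ := exists_halfTree_map_disjoint hT hd ℓ hu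
  -- Rotations around `w` give three pairwise disjoint translates of this half-tree.
  obtain ⟨y, hy, hyu, -⟩ := exists_adj_ne_ne ℓ hd w u u
  obtain ⟨z, hz, hzu, hzy⟩ := exists_adj_ne_ne ℓ hd w u y
  let t : Fin 3 → V := ![u, y, z]
  have ht : ∀ i, T.Adj w (t i) := by
    intro i
    fin_cases i
    exacts [hwu, hy, hz]
  have htinj : ∀ i j, i ≠ j → t i ≠ t j := by
    intro i j hij
    fin_cases i <;> fin_cases j <;> first | exact absurd rfl hij | skip
    exacts [hyu.symm, hzu.symm, hyu, hzy.symm, hzu, hzy]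
  have hl : ∀ i, ∃ l : L, ρ l w = w ∧ ρ l u = t i := by
    intro i
    obtain ⟨_, ⟨l, hl, rfl⟩, h1, h2⟩ := exists_mem_map_eq hT hd hF hL hwu (ht i)
    exact ⟨⟨l, hl⟩, h1, h2⟩
  choose l hlw hlu using hl
  refine ham.not_three_disjoint (ρ.comp N.subtype) hρ (fun i => halfTree T w (t i))
    (fun i j hij => disjoint_halfTree hT (ht i) (ht j) (htinj i j hij))
    (fun i => ⟨l i * n * (l i)⁻¹, hN.conj_mem n hn (l i)⟩) fun i v hv => ?_
  change ρ (l i * n * (l i)⁻¹) v ∈ halfTree T w (t i)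
  rw [← hlw i, ← hlu i, mem_halfTree_map hT] at hv
  rw [map_mul, map_mul, map_inv, RelIso.mul_apply, RelIso.mul_apply, ← hlw i, ← hlu i,
    map_mem_halfTree hT]
  exact hw _ hv

theorem amenableRadical_eq_bot (hT : T.IsTree) (hd : 3 ≤ d)
    (hF : StabilizersTransitive F) {L : Subgroup (burgerMozes ℓ F)}
    (hL : ∀ p x, T.Adj p x → ContainsRist ℓ F (L.map (burgerMozes ℓ F).subtype) p x) :
    amenableRadical L = ⊥ := by
  have := t2Space_aut T
  have hbot : sSup {N : Subgroup L | N.Normal ∧ IsClosed (N : Set L) ∧ IsAmenable N} = ⊥ :=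
    sSup_eq_bot.2 fun N ⟨hN, _, ham⟩ => eq_bot_of_normal_of_isAmenable hT hd hF hL N ham
  rw [amenableRadical, hbot]
  refine SetLike.coe_injective ?_
  rw [Subgroup.topologicalClosure_coe, Subgroup.coe_bot]
  exact isClosed_singleton.closure_eq

theorem not_isOpen_bot (hT : T.IsTree) (hd : 3 ≤ d) (hF : StabilizersTransitive F)
    {L : Subgroup (burgerMozes ℓ F)} (hL : IsOpen (L : Set (burgerMozes ℓ F))) :
    ¬ IsOpen ((⊥ : Subgroup L) : Set L) := by
  intro h
  have h1 : IsOpen ({1} : Set (burgerMozes ℓ F)) := by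
    have := hL.isOpenMap_subtype_val _ h
    simpa using this
  -- A rotation of a half-tree that avoids `S` fixes `S` pointwise and is nontrivial.
  obtain ⟨S, hS⟩ := exists_finset_of_isOpen h1 rfl
  obtain ⟨g, -, a, ha, -⟩ := exists_translation hT hd ℓ F
  obtain ⟨N, hN⟩ := ha.exists_forall_notMem hT S
  have hp := (ha.adj N).symm
  have hy := ha.adj (N + 1)
  obtain ⟨z, hz, hzp, hzy⟩ := exists_adj_ne_ne ℓ hd (a (N + 1)) (a N) (a (N + 1 + 1))
  obtain ⟨u, hu, hfix, -, huy⟩ := exists_rotation_map_eq ℓ hT hF hp hy hz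
    (by have := ha.ne N; rwa [show N + 2 = N + 1 + 1 by ring] at this) hzp
  have hu1 : u = 1 := congrArg Subtype.val (hS u hu fun v hv => hfix v (hN N le_rfl v hv))
  rw [hu1, RelIso.one_apply] at huy
  exact hzy huy.symm

theorem containsRist_of_isOpen (hT : T.IsTree) (hF : StabilizersTransitive F)
    {L : Subgroup (burgerMozes ℓ F)} (hL : IsOpen (L : Set (burgerMozes ℓ F)))
    {g : burgerMozes ℓ F} (hg : g ∈ L) {a : ℤ → V} (ha : IsLine T a)
    (hga : ∀ i, (g : T ≃g T) (a i) = a (i + 2)) {p x : V} (hpx : T.Adj p x) :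
    ContainsRist ℓ F (L.map (burgerMozes ℓ F).subtype) p x := by
  obtain ⟨S, hS⟩ := exists_finset_of_isOpen hL L.one_mem
  exact ha.containsRist_of_adj hT hF (Subgroup.map_subtype_le L) ⟨g, hg, rfl⟩ hga
    (fun u hu hfix => ⟨⟨u, hu⟩, hS u hu hfix, rfl⟩) hpx

theorem exists_geometricallyDense (hT : T.IsTree) (hd : 3 ≤ d) (hF : StabilizersTransitive F)
    (L : ℕ → Subgroup (burgerMozes ℓ F)) (hL : ∀ n, IsOpen (L n : Set (burgerMozes ℓ F)))
    (hU : (⋃ n, (L n : Set (burgerMozes ℓ F))) = Set.univ) :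
    ∃ n, GeometricallyDense ((L n).map (burgerMozes ℓ F).subtype) := by
  obtain ⟨g, hg, a, ha, hga⟩ := exists_translation hT hd ℓ F
  obtain ⟨n, hn⟩ := Set.mem_iUnion.1 (hU ▸ Set.mem_univ (⟨g, hg⟩ : burgerMozes ℓ F))
  exact ⟨n, geometricallyDense hT hd hF fun _ _ =>
    containsRist_of_isOpen hT hF (hL n) hn ha hga⟩

theorem not_isUnionOfOpenSubgroupsWithOpenAmenableRadical (hT : T.IsTree) (hd : 3 ≤ d)
    (hF : StabilizersTransitive F) :
    ¬ IsUnionOfOpenSubgroupsWithOpenAmenableRadical (burgerMozes ℓ F) := by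
  rintro ⟨𝓛, h𝓛, hU⟩
  obtain ⟨g, hg, a, ha, hga⟩ := exists_translation hT hd ℓ F
  obtain ⟨L, hL, hgL⟩ := Set.mem_iUnion₂.1 (hU ▸ Set.mem_univ (⟨g, hg⟩ : burgerMozes ℓ F))
  obtain ⟨hopen, hrad⟩ := h𝓛 L hL
  rw [amenableRadical_eq_bot hT hd hF fun _ _ =>
    containsRist_of_isOpen hT hF hopen hgL ha hga] at hrad
  exact not_isOpen_bot hT hd hF hopen hrad

end Radical

/-! ### The alternating group -/

theorem stabilizersTransitive_alternatingGroup {d : ℕ} (hd : 4 ≤ d) :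
    StabilizersTransitive (alternatingGroup (Fin d)) := by
  intro l i j hi hj
  by_cases hij : i = j
  · exact ⟨1, one_mem _, rfl, hij⟩
  obtain ⟨k, hk⟩ : ∃ k, k ∉ ({l, i, j} : Finset (Fin d)) := by
    by_contra! h
    have h1 := Finset.card_le_card fun k (_ : k ∈ Finset.univ) => h k
    rw [Finset.card_univ, Fintype.card_fin] at h1
    have := Finset.card_le_three (a := l) (b := i) (c := j)
    omega
  simp only [Finset.mem_insert, Finset.mem_singleton, not_or] at hk
  obtain ⟨hkl, hki, hkj⟩ := hk
  -- The three-cycle `i ↦ j ↦ k ↦ i`.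
  refine ⟨Equiv.swap i k * Equiv.swap i j, ?_, ?_, ?_⟩
  · rw [Equiv.Perm.mem_alternatingGroup, Equiv.Perm.sign_mul,
      Equiv.Perm.sign_swap (Ne.symm hki), Equiv.Perm.sign_swap hij]
    rfl
  · rw [Equiv.Perm.mul_apply, Equiv.swap_apply_of_ne_of_ne hi.symm hj.symm,
      Equiv.swap_apply_of_ne_of_ne hi.symm (Ne.symm hkl)]
  · rw [Equiv.Perm.mul_apply, Equiv.swap_apply_left,
      Equiv.swap_apply_of_ne_of_ne (Ne.symm hij) (Ne.symm hkj)]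

end BurgerMozes

theorem mainTheorem8 {V : Type*} (T : SimpleGraph V) [T.LocallyFinite] (d : ℕ) (hd : 3 ≤ d)
    (hT : T.IsTree) (hreg : T.IsRegularOfDegree d) (ℓ : BurgerMozes.LegalLabelling T d) :
    (∀ F : Subgroup (Equiv.Perm (Fin d)), BurgerMozes.StabilizersTransitive F →
      (∀ L : ℕ → Subgroup (BurgerMozes.burgerMozes ℓ F),
        (∀ n, IsOpen (L n : Set (BurgerMozes.burgerMozes ℓ F))) →
        (⋃ n, (L n : Set (BurgerMozes.burgerMozes ℓ F))) = Set.univ →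
        ∃ n, BurgerMozes.GeometricallyDense
          ((L n).map (BurgerMozes.burgerMozes ℓ F).subtype)) ∧
      ¬ BurgerMozes.IsUnionOfOpenSubgroupsWithOpenAmenableRadical
          (BurgerMozes.burgerMozes ℓ F)) ∧
    (4 ≤ d →
      BurgerMozes.StabilizersTransitive (alternatingGroup (Fin d)) ∧
      ¬ BurgerMozes.IsUnionOfOpenSubgroupsWithOpenAmenableRadical
          (BurgerMozes.burgerMozes ℓ (alternatingGroup (Fin d)))) := by
  have key := fun F (hF : BurgerMozes.StabilizersTransitive F) =>
    BurgerMozes.not_isUnionOfOpenSubgroupsWithOpenAmenableRadical (ℓ := ℓ) hT hd hF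
  exact ⟨fun F hF => ⟨BurgerMozes.exists_geometricallyDense hT hd hF, key F hF⟩, fun h4 =>
    ⟨BurgerMozes.stabilizersTransitive_alternatingGroup h4,
      key _ (BurgerMozes.stabilizersTransitive_alternatingGroup h4)⟩⟩
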